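/- Let $\Gamma$ be a finitely generated group and $H_1,\dots,H_k$ ($k\ge 0$) subgroups of $\Gamma$. For a finite generating set $S$ of $\Gamma$, the coned-off graph $\widehat{\mathrm{Cay}}(\Gamma,S)$ is obtained from the (simplicial, undirected) Cayley graph of $\Gamma$ with respect to $S$, in which distinct $g$ and $g'$ are adjacent when $g^{-1}g'\in S\cup S^{-1}$, by adding, for each $i$ and each left coset $gH_i$, a new vertex $\widehat{gH_i}$ joined by an edge to every element of $gH_i$. The group $\Gamma$ acts on it by left translation. A connected graph is hyperbolic if there is $\delta>0$ such that in every geodesic triangle each side is contained in the $\delta$-neighbourhood of the union of the other two sides. A graph is uniformly fine if there is a function $\varphi:\mathbb{N}\to\mathbb{N}$ such that for every edge $e$ and every $L\in\mathbb{N}$, there are at most $\varphi(L)$ simple loops of length at most $L$ containing $e$. Suppose that $\Gamma$ is hyperbolic relative to $(H_1,\dots,H_k)$, that is, for some finite generating set $S$ of $\Gamma$ the graph $\widehat{\mathrm{Cay}}(\Gamma,S)$ is hyperbolic and uniformly fine. Let $T$ be any finite generating set of $\Gamma$ and let $G$ be a subgroup of $\Gamma$ all of whose orbits on the vertices of $\widehat{\mathrm{Cay}}(\Gamma,T)$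 are bounded for the graph metric. Then either $G$ is finite, or there are an index $i$ and an element $g\in\Gamma$ such that $G\subseteq gH_ig^{-1}$. -/

import Mathlib

namespace RelHyp

/-- A walk of a graph is geodesic if it is as short as the distance between its endpoints. -/
def IsGeodesic {V : Type*} {X : SimpleGraph V} {x y : V} (p : X.Walk x y) : Prop :=
  p.length = X.dist x y

/-- A connected graph is `δ`-hyperbolic if, in every geodesic triangle, each side lies in the
`δ`-neighbourhood of the union of the other two. (The sides play symmetric roles because the
triangle, its vertices in any order, is arbitrary.) -/
def IsDeltaHyperbolic {V : Type*} (X : SimpleGraph V) (δ : ℝ) : Prop :=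
  X.Connected ∧
    ∀ (x y z : V) (p : X.Walk x y) (q : X.Walk y z) (r : X.Walk x z),
      IsGeodesic p → IsGeodesic q → IsGeodesic r →
        ∀ v ∈ p.support, ∃ u, (u ∈ q.support ∨ u ∈ r.support) ∧ (X.dist v u : ℝ) ≤ δ

/-- Gromov hyperbolicity of a graph. -/
def IsHyperbolic {V : Type*} (X : SimpleGraph V) : Prop :=
  ∃ δ : ℝ, 0 < δ ∧ IsDeltaHyperbolic X δ

/-- The simple loops of length at most `L` which contain the edge `e`, seen as subgraphs
(that is, without base point and orientation). -/
def simpleLoops {V : Type*} (X : SimpleGraph V) (e : Sym2 V) (L : ℕ) : Set X.Subgraph :=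
  {C | ∃ (v : V) (w : X.Walk v v),
    w.IsCycle ∧ w.length ≤ L ∧ e ∈ w.edges ∧ C = w.toSubgraph}

/-- A graph is uniformly fine if the number of simple loops of length at most `L` through an edge
is finite and bounded by a function of `L` only. -/
def IsUniformlyFine {V : Type*} (X : SimpleGraph V) : Prop :=
  ∃ φ : ℕ → ℕ, ∀ e ∈ X.edgeSet, ∀ L : ℕ, (simpleLoops X e L).encard ≤ (φ L : ℕ∞)

/-- The vertices of a coned-off graph: the elements of the group, and one further vertex for each
index `i` and each left coset of `H i`. The group acts on them by left translation. -/
abbrev ConedOffVertex {Γ : Type*} [Group Γ] {k : ℕ} (H : Fin k → Subgroup Γ) : Type _ :=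
  Γ ⊕ (Σ i : Fin k, Γ ⧸ H i)

/-- The coned-off Cayley graph: the Cayley graph of `Γ` with respect to `S`, where the vertex of
each left coset `c` of `H i` is joined to all the elements of `c`. -/
def conedOff {Γ : Type*} [Group Γ] {k : ℕ} (H : Fin k → Subgroup Γ) (S : Set Γ) :
    SimpleGraph (ConedOffVertex H) where
  Adj
    | Sum.inl a, Sum.inl b => (SimpleGraph.mulCayley S).Adj a b
    | Sum.inl a, Sum.inr c => (QuotientGroup.mk a : Γ ⧸ H c.1) = c.2
    | Sum.inr c, Sum.inl a => (QuotientGroup.mk a : Γ ⧸ H c.1) = c.2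
    | Sum.inr _, Sum.inr _ => False
  symm := by
    constructor
    rintro (a | c) (b | d) h
    · exact SimpleGraph.Adj.symm h
    · exact h
    · exact h
    · exact h
  loopless := by
    constructor
    rintro (a | c) h
    · exact SimpleGraph.irrefl _ h
    · exact h

/-- Left translation is an action on the coned-off graph by graph automorphisms. -/
theorem conedOff_adj_smul {Γ : Type*} [Group Γ] {k : ℕ} (H : Fin k → Subgroup Γ) (S : Set Γ)
    (g : Γ) (x y : ConedOffVertex H) :
    (conedOff H S).Adj (g • x) (g • y) ↔ (conedOff H S).Adj x y := by
  have key : ∀ (a : Γ) (c : Σ i : Fin k, Γ ⧸ H i),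
      (QuotientGroup.mk (g * a) : Γ ⧸ H c.1) = g • c.2 ↔ (QuotientGroup.mk a : Γ ⧸ H c.1) = c.2 := by
    intro a c
    exact (MulAction.injective g).eq_iff (a := (QuotientGroup.mk a : Γ ⧸ H c.1))
  rcases x with a | c <;> rcases y with b | d
  · change (SimpleGraph.mulCayley S).Adj (g * a) (g * b) ↔ (SimpleGraph.mulCayley S).Adj a b
    simp [SimpleGraph.mulCayley_adj', mul_assoc]
  · exact key a d
  · exact key b c
  · exact Iff.rfl

/-- `Γ` is finitely generated and hyperbolic relative to `H 0, …, H (k - 1)`: the coned-off graph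
for some finite generating set is hyperbolic and uniformly fine. -/
def IsRelativelyHyperbolic {Γ : Type*} [Group Γ] {k : ℕ} (H : Fin k → Subgroup Γ) : Prop :=
  ∃ S : Set Γ, S.Finite ∧ Subgroup.closure S = ⊤ ∧
    IsHyperbolic (conedOff H S) ∧ IsUniformlyFine (conedOff H S)

/-- Every orbit of a group acting on the vertices of a graph is bounded for the graph metric. -/
def HasBoundedOrbits (G : Type*) [Group G] {V : Type*} [MulAction G V] (X : SimpleGraph V) :
    Prop :=
  ∀ x : V, ∃ R : ℕ, ∀ y ∈ MulAction.orbit G x, ∀ z ∈ MulAction.orbit G x, X.edist y z ≤ (R : ℕ∞)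

end RelHyp

namespace RelHyp

open SimpleGraph

/-! Fineness bounds the directions at a vertex `w` that stay close to a given one off `w`, and thin
triangles show that a geodesic missing `w` makes the directions of its ends close. So all but
finitely many directions make a large angle with a given one, and distances then add through `w`
(`exists_finite_dist_eq_add`).

Let `G` be infinite with bounded orbits. A bounded infinite orbit `G • y` is seen from some vertex
in infinitely many directions; among such vertices take `w` closest to `y`. If `G` moved `w`,
additivity and a maximal displacement would leave finitely many directions from `w` to `G • w`;
additivity and minimality would then make the stabilizer of `w` infinite. That stabilizer acts
freely on the neighbours of `w` and permutes those finitely many directions, which is absurd. So `w`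
is fixed, hence a cone vertex, whose stabilizer is a conjugate of some `H i`. -/

/-- There is a walk of length at most `n` from `u` to `v` which avoids the vertex `w`. -/
def AvoidReach {V : Type*} (X : SimpleGraph V) (w : V) (n : ℕ) (u v : V) : Prop :=
  ∃ p : X.Walk u v, w ∉ p.support ∧ p.length ≤ n

/-- The vertex `s` is the first one after `w` on some geodesic from `w` to `x`. -/
def IsFirstStep {V : Type*} (X : SimpleGraph V) (w s x : V) : Prop :=
  X.Adj w s ∧ X.dist w x = X.dist s x + 1

/-! ### Angles and directions in fine hyperbolic graphs -/

section Graph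

variable {V : Type*} {X : SimpleGraph V} {w u v x s t : V} {m n : ℕ}

theorem AvoidReach.symm (h : AvoidReach X w n u v) : AvoidReach X w n v u := by
  obtain ⟨p, hp, hn⟩ := h
  exact ⟨p.reverse, by simpa using hp, by simpa using hn⟩

theorem AvoidReach.trans (h : AvoidReach X w m u v) (h' : AvoidReach X w n v x) :
    AvoidReach X w (m + n) u x := by
  obtain ⟨p, hp, hm⟩ := h
  obtain ⟨q, hq, hn⟩ := h'
  refine ⟨p.append q, ?_, ?_⟩
  · rw [Walk.mem_support_append_iff]
    tauto
  · rw [Walk.length_append]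
    omega

theorem AvoidReach.mono (h : AvoidReach X w m u v) (hmn : m ≤ n) : AvoidReach X w n u v := by
  obtain ⟨p, hp, hm⟩ := h
  exact ⟨p, hp, hm.trans hmn⟩

theorem avoidReach_of_dist_lt (hc : X.Connected) (hn : X.dist u v ≤ n) (hw : n < X.dist u w) :
    AvoidReach X w n u v := by
  classical
  obtain ⟨p, hp⟩ := hc.exists_walk_length_eq_dist u v
  refine ⟨p, fun h => ?_, by omega⟩
  have h1 := dist_le (p.takeUntil w h)
  have h2 := p.length_takeUntil_le_length h
  omega

/-- In a uniformly fine graph, only finitely many neighbours of `w` can be reached from a given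
one within a given length while avoiding `w`. -/
theorem finite_setOf_avoidReach (hf : IsUniformlyFine X) (hwt : X.Adj w t) (L : ℕ) :
    {s | X.Adj w s ∧ AvoidReach X w L t s}.Finite := by
  classical
  obtain ⟨φ, hφ⟩ := hf
  have hfin : (simpleLoops X s(w, t) (L + 2)).Finite :=
    Set.finite_of_encard_le_coe (hφ s(w, t) hwt (L + 2))
  have hverts : ∀ C ∈ simpleLoops X s(w, t) (L + 2), C.verts.Finite := by
    rintro C ⟨v, c, -, -, -, rfl⟩
    rw [Walk.verts_toSubgraph]
    exact List.finite_toSet c.support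
  refine ((hfin.biUnion hverts).union (Set.finite_singleton t)).subset ?_
  rintro s ⟨hws, p, hp, hpL⟩
  by_cases hst : s = t
  · exact Or.inr hst
  left
  have hb : w ∉ p.bypass.support := fun h => hp (p.support_bypass_subset_support h)
  have hbl := p.length_bypass_le_length
  -- The simple loop `w`, `t`, path to `s`, `w`: the two edges at `w` account for `L + 2`.
  refine Set.mem_biUnion (x := (Walk.cons hwt (p.bypass.concat hws.symm)).toSubgraph)
    ⟨w, _, ?_, ?_, ?_, rfl⟩ ?_
  · rw [Walk.cons_isCycle_iff, Walk.concat_isPath_iff]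
    refine ⟨⟨p.bypass_isPath, hb⟩, ?_⟩
    rw [Walk.edges_concat, List.concat_eq_append, List.mem_append, List.mem_singleton, Sym2.eq_iff]
    rintro (h | ⟨h, -⟩ | ⟨-, h⟩)
    · exact hb (Walk.fst_mem_support_of_mem_edges _ h)
    · exact hws.ne h
    · exact hst h.symm
  · simp only [Walk.length_cons, Walk.length_concat]
    omega
  · simp
  · simp [Walk.support_concat]

theorem exists_isFirstStep (hc : X.Connected) (h : w ≠ x) : ∃ s, IsFirstStep X w s x := by
  obtain ⟨p, hp⟩ := hc.exists_walk_length_eq_dist w x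
  cases p with
  | nil => exact absurd rfl h
  | @cons _ s _ hs p =>
    refine ⟨s, hs, ?_⟩
    have h1 := dist_le p
    have h2 := hc.dist_triangle (u := w) (v := s) (w := x)
    have h3 := dist_eq_one_iff_adj.2 hs
    simp only [Walk.length_cons] at hp
    omega

/-- A geodesic from `w` through `s` never returns to `w`; the extra `1` is the edge from `s` to `w`.
-/
theorem avoidReach_of_mem_support (hc : X.Connected) {a : V} (hs : IsFirstStep X w s a)
    {p : X.Walk s a} (hp : IsGeodesic p) (hu : u ∈ p.support) :
    AvoidReach X w (X.dist w u + 1) s u := by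
  classical
  refine ⟨p.takeUntil u hu, fun h => ?_, ?_⟩
  · have h' := p.support_takeUntil_subset_support hu h
    have h1 := dist_le (p.dropUntil w h')
    have h2 := p.length_dropUntil_le_length h'
    have h3 := hs.2
    unfold IsGeodesic at hp
    omega
  · rw [length_eq_dist_of_subwalk hp (p.isSubwalk_takeUntil hu)]
    have h2 := hc.dist_triangle (u := s) (v := w) (w := u)
    have h3 := dist_eq_one_iff_adj.2 hs.1.symm
    omega

theorem exists_mem_support_dist (hc : X.Connected) {a : V} (hs : IsFirstStep X w s a)
    {p : X.Walk s a} (hp : IsGeodesic p) (hm : 0 < m) :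
    ∃ u ∈ p.support, X.dist w u ≤ m ∧ (u = a ∨ X.dist w u = m) := by
  unfold IsGeodesic at hp
  have hs2 := hs.2
  rcases le_or_gt (X.dist w a) m with h | h
  · exact ⟨a, p.end_mem_support, h, Or.inl rfl⟩
  · have h0 := dist_eq_one_iff_adj.2 hs.1
    have h1 := dist_le (p.take (m - 1))
    have h2 := dist_le (p.drop (m - 1))
    rw [Walk.take_length] at h1
    rw [Walk.drop_length] at h2
    have h3 := hc.dist_triangle (u := w) (v := s) (w := p.getVert (m - 1))
    have h4 := hc.dist_triangle (u := w) (v := p.getVert (m - 1)) (w := a)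
    have h5 : X.dist w (p.getVert (m - 1)) = m := by omega
    exact ⟨p.getVert (m - 1), p.getVert_mem_support _, h5.le, Or.inr h5⟩

theorem avoidReach_of_mem_geodesic {a z z' : V} {q : X.Walk x a} (hq : IsGeodesic q)
    (hw : w ∉ q.support) (hz : z ∈ q.support) (hz' : z' ∈ q.support) :
    AvoidReach X w (X.dist z z') z z' := by
  classical
  have hmem := hz'
  rw [← q.take_spec hz, Walk.mem_support_append_iff] at hmem
  rcases hmem with h | h
  · refine AvoidReach.symm ⟨(q.takeUntil z hz).dropUntil z' h, fun h' => hw ?_, ?_⟩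
    · exact q.support_takeUntil_subset_support hz
        ((q.takeUntil z hz).support_dropUntil_subset_support h h')
    · rw [length_eq_dist_of_subwalk hq (((q.takeUntil z hz).isSubwalk_dropUntil h).trans
        (q.isSubwalk_takeUntil hz)), dist_comm]
  · refine ⟨(q.dropUntil z hz).takeUntil z' h, fun h' => hw ?_, ?_⟩
    · exact q.support_dropUntil_subset_support hz
        ((q.dropUntil z hz).support_takeUntil_subset_support h h')
    · rw [length_eq_dist_of_subwalk hq (((q.dropUntil z hz).isSubwalk_takeUntil h).trans
        (q.isSubwalk_dropUntil hz))]

/-- If some geodesic from `x` to `a` misses `w`, then the first steps from `w` to `x` and to `a` are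
joined by a short path avoiding `w`. -/
theorem avoidReach_of_geodesic_avoids {δ : ℝ} (hX : IsDeltaHyperbolic X δ) {a : V}
    (ht : IsFirstStep X w t x) (hs : IsFirstStep X w s a) {q : X.Walk x a} (hq : IsGeodesic q)
    (hw : w ∉ q.support) : AvoidReach X w (8 * ⌈δ⌉₊ + 6) t s := by
  obtain ⟨hc, hthin⟩ := hX
  set d := ⌈δ⌉₊ with hd
  have hle : ∀ y z : V, (X.dist y z : ℝ) ≤ δ → X.dist y z ≤ d := fun y z h => by
    exact_mod_cast h.trans (Nat.le_ceil δ)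
  obtain ⟨p, hp⟩ := hc.exists_walk_length_eq_dist t x
  obtain ⟨r, hr⟩ := hc.exists_walk_length_eq_dist s a
  have hp' : IsGeodesic (Walk.cons ht.1 p) := by
    simp only [IsGeodesic, Walk.length_cons]; rw [ht.2, hp]
  have hr' : IsGeodesic (Walk.cons hs.1 r) := by
    simp only [IsGeodesic, Walk.length_cons]; rw [hs.2, hr]
  have hq' : IsGeodesic q.reverse := by
    simp only [IsGeodesic, Walk.length_reverse]; rw [dist_comm]; exact hq
  -- At distance `d + 1` from `w`, a geodesic of length at most `d` cannot meet `w`. A shorter side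
  -- is cut at its end, which lies on `q`.
  obtain ⟨u, hu, hum, hu'⟩ := exists_mem_support_dist hc ht hp (Nat.succ_pos d)
  obtain ⟨v, hv, hvm, hv'⟩ := exists_mem_support_dist hc hs hr (Nat.succ_pos d)
  have hut := avoidReach_of_mem_support hc ht hp hu
  have hvs := (avoidReach_of_mem_support hc hs hr hv).symm
  have A : ∃ z, (z ∈ q.support ∨ z ∈ r.support) ∧ X.dist u z ≤ d ∧ AvoidReach X w d u z := by
    rcases hu' with rfl | hu'
    · have hxw : u ≠ w := fun h => hw (h ▸ q.start_mem_support)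
      exact ⟨u, Or.inl q.start_mem_support, by simp, Walk.nil, by simpa using hxw.symm, by simp⟩
    · obtain ⟨z, hz, hz'⟩ := hthin _ _ _ _ q _ hp' hq hr' u (by simp [hu])
      have hz' := hle _ _ hz'
      have hz2 : AvoidReach X w d u z :=
        avoidReach_of_dist_lt hc hz' (by rw [dist_comm, hu']; omega)
      refine ⟨z, ?_, hz', hz2⟩
      rcases hz with hz | hz
      · exact Or.inl hz
      · rcases List.mem_cons.1 (by simpa using hz) with rfl | h
        · rw [dist_comm] at hz'; omega
        · exact Or.inr h
  have B : ∃ z, (z ∈ q.support ∨ z ∈ p.support) ∧ X.dist v z ≤ d ∧ AvoidReach X w d v z := by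
    rcases hv' with rfl | hv'
    · have hxw : v ≠ w := fun h => hw (h ▸ q.end_mem_support)
      exact ⟨v, Or.inl q.end_mem_support, by simp, Walk.nil, by simpa using hxw.symm, by simp⟩
    · obtain ⟨z, hz, hz'⟩ := hthin _ _ _ _ q.reverse _ hr' hq' hp' v (by simp [hv])
      have hz' := hle _ _ hz'
      have hz2 : AvoidReach X w d v z :=
        avoidReach_of_dist_lt hc hz' (by rw [dist_comm, hv']; omega)
      refine ⟨z, ?_, hz', hz2⟩
      rcases hz with hz | hz
      · exact Or.inl (by simpa using hz)
      · rcases List.mem_cons.1 (by simpa using hz) with rfl | h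
        · rw [dist_comm] at hz'; omega
        · exact Or.inr h
  obtain ⟨z, hz, huz, hauz⟩ := A
  obtain ⟨z', hz', hvz, havz⟩ := B
  have t1 := hc.dist_triangle (u := w) (v := u) (w := z)
  have t2 := hc.dist_triangle (u := w) (v := v) (w := z')
  rcases hz with hz | hz
  · rcases hz' with hz' | hz'
    · have hzz := avoidReach_of_mem_geodesic hq hw hz hz'
      have t3 := hc.dist_triangle (u := z) (v := u) (w := z')
      have t4 := hc.dist_triangle (u := u) (v := w) (w := z')
      rw [dist_comm (u := z) (v := u)] at t3
      rw [dist_comm (u := u) (v := w)] at t4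
      -- The pieces have lengths at most `d + 2`, `d`, `4 * d + 2`, `d` and `d + 2`, whence `8 * d +
      -- 6`.
      exact ((((hut.trans hauz).trans hzz).trans havz.symm).trans hvs).mono (by omega)
    · have hzz := avoidReach_of_mem_support hc ht hp hz'
      exact ((hzz.trans havz.symm).trans hvs).mono (by omega)
  · have hzz := avoidReach_of_mem_support hc hs hr hz
    exact ((hut.trans hauz).trans hzz.symm).mono (by omega)

/-- In a hyperbolic uniformly fine graph, all but finitely many directions at `w` make a large
angle with finitely many given ones, so that geodesics between them pass through `w`. -/
theorem exists_finite_dist_eq_add (hX : IsHyperbolic X) (hf : IsUniformlyFine X) (w : V)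
    {F : Set V} (hF : F.Finite) :
    ∃ E : Set V, E.Finite ∧ ∀ s ∉ E, ∀ t ∈ F, ∀ x a : V, IsFirstStep X w t x →
      IsFirstStep X w s a → X.dist x a = X.dist w x + X.dist w a := by
  classical
  obtain ⟨δ, -, hδ⟩ := hX
  refine ⟨⋃ t ∈ F, {s | X.Adj w t ∧ X.Adj w s ∧ AvoidReach X w (8 * ⌈δ⌉₊ + 6) t s},
    hF.biUnion fun t _ => ?_, fun s hs t ht x a htx hsa => ?_⟩
  · by_cases h : X.Adj w t
    · simpa [h] using finite_setOf_avoidReach hf h (8 * ⌈δ⌉₊ + 6)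
    · simp [h]
  · obtain ⟨q, hq⟩ := hδ.1.exists_walk_length_eq_dist x a
    have hw : w ∈ q.support := by
      by_contra hw
      exact hs (Set.mem_biUnion ht
        ⟨htx.1, hsa.1, avoidReach_of_geodesic_avoids hδ htx hsa hq hw⟩)
    have h1 := dist_le (q.takeUntil w hw)
    have h2 := dist_le (q.dropUntil w hw)
    have h3 := congrArg Walk.length (q.take_spec hw)
    rw [Walk.length_append] at h3
    have h4 := hδ.1.dist_triangle (u := x) (v := w) (w := a)
    rw [dist_comm (u := x) (v := w)] at h1 h4
    omega

/-- A bounded infinite set of vertices of a connected graph is reached from some vertex in infinitely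
many directions. -/
theorem exists_infinite_isFirstStep (hc : X.Connected) {A : Set V} (hA : A.Infinite) {y : V}
    {R : ℕ} (hR : ∀ a ∈ A, X.dist y a ≤ R) :
    ∃ w, {s | ∃ a ∈ A, IsFirstStep X w s a}.Infinite := by
  by_contra! h
  -- König's argument: with finitely many directions everywhere, every ball meets `A` in a finite
  -- set.
  have key : ∀ n v, {a ∈ A | X.dist v a ≤ n}.Finite := by
    intro n
    induction n with
    | zero =>
      intro v
      refine (Set.finite_singleton v).subset fun a ha => ?_
      exact (hc.dist_eq_zero_iff.1 (Nat.le_zero.1 ha.2)).symm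
    | succ n ih =>
      intro v
      refine (((h v).biUnion fun s _ => ih s).union
        (Set.finite_singleton v)).subset ?_
      rintro a ⟨ha, han⟩
      by_cases hav : a = v
      · exact Or.inr hav
      · obtain ⟨s, hs⟩ := exists_isFirstStep hc (Ne.symm hav)
        have := hs.2
        exact Or.inl (Set.mem_biUnion (x := s) ⟨a, ha, hs⟩ ⟨ha, by omega⟩)
  exact hA ((key R y).subset fun a ha => ⟨ha, hR a ha⟩)

end Graph

/-! ### Groups with bounded orbits -/

section Action

variable {V : Type*} {X : SimpleGraph V}

/-- Two directions towards `a` at a large angle would give `X.dist a a = 2 * X.dist w a > 0`. -/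
theorem finite_setOf_isFirstStep (hX : IsHyperbolic X) (hf : IsUniformlyFine X) (w a : V) :
    {s | IsFirstStep X w s a}.Finite := by
  rcases Set.eq_empty_or_nonempty {s | IsFirstStep X w s a} with h | ⟨t, ht⟩
  · simp [h]
  · obtain ⟨E, hE, hE'⟩ := exists_finite_dist_eq_add hX hf w (Set.finite_singleton t)
    refine hE.subset fun s hs => ?_
    by_contra hsE
    have h1 := hE' s hsE t rfl a a ht hs
    have h2 := hs.2
    rw [SimpleGraph.dist_self] at h1
    omega

variable {G : Type*} [Group G] [MulAction G V]

theorem dist_smul_smul (hc : X.Connected) (hadj : ∀ (g : G) x y, X.Adj (g • x) (g • y) ↔ X.Adj x y)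
    (g : G) (x y : V) : X.dist (g • x) (g • y) = X.dist x y := by
  have key : ∀ (g : G) x y, X.dist (g • x) (g • y) ≤ X.dist x y := fun g x y => by
    obtain ⟨p, hp⟩ := hc.exists_walk_length_eq_dist x y
    let f : X →g X := ⟨fun v => g • v, fun h => (hadj g _ _).2 h⟩
    rw [← hp, ← Walk.length_map f]
    exact dist_le (p.map f)
  refine le_antisymm (key g x y) ?_
  simpa using key g⁻¹ (g • x) (g • y)

theorem IsFirstStep.smul (hc : X.Connected)
    (hadj : ∀ (g : G) x y, X.Adj (g • x) (g • y) ↔ X.Adj x y) {w s x : V}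
    (h : IsFirstStep X w s x) (g : G) : IsFirstStep X (g • w) (g • s) (g • x) := by
  refine ⟨(hadj g w s).2 h.1, ?_⟩
  rw [dist_smul_smul hc hadj, dist_smul_smul hc hadj]
  exact h.2

theorem HasBoundedOrbits.exists_dist_le (hc : X.Connected) (hG : HasBoundedOrbits G X) (x : V) :
    ∃ R : ℕ, ∀ g : G, X.dist x (g • x) ≤ R := by
  obtain ⟨R, hR⟩ := hG x
  refine ⟨R, fun g => ?_⟩
  have h := hR x (MulAction.mem_orbit_self x) (g • x) (MulAction.mem_orbit x g)
  rw [← (hc x (g • x)).coe_dist_eq_edist] at h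
  exact_mod_cast h

/-- An infinite group with bounded orbits on a hyperbolic uniformly fine graph fixes a vertex, if
it acts freely on some orbit and on the neighbours of vertices with infinite stabilizer. -/
theorem exists_fixed_of_hasBoundedOrbits [Infinite G] (hX : IsHyperbolic X)
    (hf : IsUniformlyFine X) (hadj : ∀ (g : G) x y, X.Adj (g • x) (g • y) ↔ X.Adj x y)
    (hG : HasBoundedOrbits G X) (y : V) (hy : Function.Injective fun g : G => g • y)
    (hfree : ∀ w, {g : G | g • w = w}.Infinite → ∀ t, X.Adj w t →
      Function.Injective fun g : G => g • t) :
    ∃ w : V, ∀ g : G, g • w = w := by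
  have hc : X.Connected := by
    obtain ⟨δ, -, h⟩ := hX
    exact h.1
  have hd := dist_smul_smul hc hadj
  set A : Set V := Set.range fun g : G => g • y with hA
  set W : Set V := {w | {s | ∃ a ∈ A, IsFirstStep X w s a}.Infinite} with hW
  have hWne : W.Nonempty := by
    obtain ⟨R, hR⟩ := hG.exists_dist_le hc y
    refine exists_infinite_isFirstStep hc (Set.infinite_range_of_injective hy) (y := y) (R := R) ?_
    rintro _ ⟨g, rfl⟩
    exact hR g
  have hWsmul : ∀ w ∈ W, ∀ g : G, g • w ∈ W := by
    intro w hw g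
    refine (Set.Infinite.image (MulAction.injective g).injOn hw).mono ?_
    rintro _ ⟨s, ⟨_, ⟨k, rfl⟩, hs⟩, rfl⟩
    exact ⟨g • k • y, ⟨g * k, mul_smul g k y⟩, hs.smul hc hadj g⟩
  obtain ⟨w, hw, hmin⟩ := (measure (X.dist y)).wf.has_min W hWne
  have hmin : ∀ v ∈ W, X.dist y w ≤ X.dist y v := fun v hv => not_lt.1 (hmin v hv)
  refine ⟨w, ?_⟩
  by_contra! hne
  obtain ⟨h, hh, hmax⟩ : ∃ h : G, h • w ≠ w ∧ ∀ g : G, X.dist w (g • w) ≤ X.dist w (h • w) := by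
    obtain ⟨R, hR⟩ := hG.exists_dist_le hc w
    have hbdd : BddAbove (Set.range fun g : G => X.dist w (g • w)) := by
      refine ⟨R, ?_⟩
      rintro _ ⟨g, rfl⟩
      exact hR g
    obtain ⟨h, hh⟩ := Nat.sSup_mem (Set.range_nonempty fun g : G => X.dist w (g • w)) hbdd
    have hmax : ∀ g : G, X.dist w (g • w) ≤ X.dist w (h • w) := fun g => by
      simp only at hh
      rw [hh]
      exact le_csSup hbdd ⟨g, rfl⟩
    refine ⟨h, fun h0 => ?_, hmax⟩
    obtain ⟨g, hg⟩ := hne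
    have h1 := hmax g
    rw [h0, SimpleGraph.dist_self] at h1
    exact hg (hc.dist_eq_zero_iff.1 (Nat.le_zero.1 h1)).symm
  obtain ⟨t, ht⟩ := exists_isFirstStep hc hh.symm
  -- A direction to `g • w` at a large angle with `t` would put `g • w` farther from `h • w` than
  -- the maximal displacement allows.
  have hN : {s | ∃ g : G, IsFirstStep X w s (g • w)}.Finite := by
    obtain ⟨E, hE, hE'⟩ := exists_finite_dist_eq_add hX hf w (Set.finite_singleton t)
    refine hE.subset ?_
    rintro s ⟨g, hs⟩
    by_contra hsE
    have h1 := hE' s hsE t rfl _ _ ht hs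
    have h2 := hs.2
    have h3 := hmax (h⁻¹ * g)
    rw [← hd h, ← mul_smul, mul_inv_cancel_left] at h3
    omega
  -- Otherwise some `g` moving `w` has the directions to `g • w` and `g • y` at a large angle, so
  -- `g⁻¹ • w` is closer to `y` than `w`.
  have hK : {g : G | g • w = w}.Infinite := by
    intro hK
    obtain ⟨E, hE, hE'⟩ := exists_finite_dist_eq_add hX hf w hN
    refine hw (((hK.biUnion fun g _ => finite_setOf_isFirstStep hX hf w (g • y)).union hE).subset ?_)
    rintro s ⟨_, ⟨g, rfl⟩, hs⟩
    change IsFirstStep X w s (g • y) at hs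
    by_cases hsE : s ∈ E
    · exact Or.inr hsE
    refine Or.inl (Set.mem_biUnion (x := g) ?_ hs)
    by_contra hg
    change g • w ≠ w at hg
    obtain ⟨t', ht'⟩ := exists_isFirstStep hc hg.symm
    have h1 := hE' s hsE t' ⟨g, ht'⟩ _ _ ht' hs
    have h2 := hmin _ (hWsmul w hw g⁻¹)
    have h3 := ht'.2
    rw [hd, dist_comm] at h1
    rw [← hd g y (g⁻¹ • w), smul_inv_smul, dist_comm (u := g • y)] at h2
    omega
  -- The translates of `t` by the stabilizer are infinitely many directions from `w` to its orbit.
  refine (hK.image (hfree w hK t ht.1).injOn) (hN.subset ?_)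
  rintro _ ⟨k, hk, rfl⟩
  refine ⟨k * h, ?_⟩
  have := ht.smul hc hadj k
  rwa [show k • w = w from hk, ← mul_smul] at this

end Action

/-! ### Coned-off graphs: change of generators and stabilizers -/

section ConedOff

variable {Γ : Type*} [Group Γ] {k : ℕ} (H : Fin k → Subgroup Γ)

/-- Changing the finite generating set distorts the coned-off graph by a Lipschitz map. -/
theorem exists_dist_le_mul_length {S T : Set Γ} (hc : (conedOff H S).Connected) (hT : T.Finite) :
    ∃ C : ℕ, ∀ (x y : ConedOffVertex H) (p : (conedOff H T).Walk x y),
      (conedOff H S).dist x y ≤ C * p.length := by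
  obtain ⟨C, hC⟩ := (hT.image fun g : Γ =>
    (conedOff H S).dist (Sum.inl 1) (Sum.inl g)).bddAbove
  have hC : ∀ g ∈ T, (conedOff H S).dist (Sum.inl 1) (Sum.inl g) ≤ C :=
    fun g hg => hC ⟨g, hg, rfl⟩
  have hmul : ∀ a g : Γ, (conedOff H S).dist (Sum.inl a) (Sum.inl (a * g)) =
      (conedOff H S).dist (Sum.inl 1) (Sum.inl g) := fun a g => by
    have h := dist_smul_smul hc (conedOff_adj_smul H S) a (Sum.inl 1) (Sum.inl g)
    rwa [Sum.smul_inl, Sum.smul_inl, smul_eq_mul, smul_eq_mul, mul_one] at h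
  refine ⟨C + 1, fun x y p => ?_⟩
  have hedge : ∀ x y, (conedOff H T).Adj x y → (conedOff H S).dist x y ≤ C + 1 := by
    rintro (a | c) (b | d) h
    · obtain ⟨-, g, hg, rfl | rfl⟩ := (mulCayley_adj' T a b).1 h
      · rw [hmul]
        exact (hC g hg).trans (Nat.le_succ C)
      · rw [dist_comm, hmul]
        exact (hC g hg).trans (Nat.le_succ C)
    · have h' : (conedOff H S).Adj (Sum.inl a) (Sum.inr d) := h
      rw [dist_eq_one_iff_adj.2 h']
      omega
    · have h' : (conedOff H S).Adj (Sum.inr c) (Sum.inl b) := h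
      rw [dist_eq_one_iff_adj.2 h']
      omega
    · exact h.elim
  induction p with
  | nil => simp
  | @cons u v z h p ih =>
    have h1 := hc.dist_triangle (u := u) (v := v) (w := z)
    have h2 := hedge _ _ h
    rw [Walk.length_cons, mul_add, mul_one]
    omega

theorem HasBoundedOrbits.conedOff_of_connected {S T : Set Γ} (hc : (conedOff H S).Connected)
    (hT : T.Finite) {G : Subgroup Γ} (hG : HasBoundedOrbits G (conedOff H T)) :
    HasBoundedOrbits G (conedOff H S) := by
  obtain ⟨C, hC⟩ := exists_dist_le_mul_length H hc hT
  intro x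
  obtain ⟨R, hR⟩ := hG x
  refine ⟨C * R, fun y hy z hz => ?_⟩
  have h := hR y hy z hz
  obtain ⟨p, hp⟩ := exists_walk_of_edist_ne_top (ne_top_of_le_ne_top (ENat.natCast_ne_top R) h)
  rw [← hp] at h
  rw [← (hc y z).coe_dist_eq_edist]
  exact_mod_cast (hC y z p).trans (Nat.mul_le_mul_left C (by exact_mod_cast h))

theorem smul_inl_injective (G : Subgroup Γ) (a : Γ) :
    Function.Injective fun g : G => g • (Sum.inl a : ConedOffVertex H) := fun g g' h => by
  have h' : (g : Γ) * a = (g' : Γ) * a := Sum.inl_injective h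
  exact Subtype.ext (mul_right_cancel h')

theorem le_map_conj_of_forall_smul_eq {G : Subgroup Γ} {i : Fin k} {a : Γ}
    (h : ∀ g : G, g • (Sum.inr ⟨i, (a : Γ ⧸ H i)⟩ : ConedOffVertex H) = Sum.inr ⟨i, (a : Γ ⧸ H i)⟩) :
    G ≤ (H i).map (MulAut.conj a).toMonoidHom := by
  intro g hg
  have h1 : (⟨i, ((g * a : Γ) : Γ ⧸ H i)⟩ : Σ i : Fin k, Γ ⧸ H i) = ⟨i, (a : Γ ⧸ H i)⟩ :=
    Sum.inr_injective (h ⟨g, hg⟩)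
  have h2 : ((g * a : Γ) : Γ ⧸ H i) = (a : Γ ⧸ H i) := by simpa using h1
  have h3 : a⁻¹ * (g * a) ∈ H i := QuotientGroup.eq.1 h2.symm
  exact ⟨a⁻¹ * (g * a), h3, by simp [mul_assoc]⟩

end ConedOff

end RelHyp

theorem mainTheorem5 {Γ : Type*} [Group Γ] {k : ℕ} (H : Fin k → Subgroup Γ)
    (hΓ : RelHyp.IsRelativelyHyperbolic H)
    (T : Set Γ) (hTfin : T.Finite) (hTgen : Subgroup.closure T = ⊤)
    (G : Subgroup Γ) (hG : RelHyp.HasBoundedOrbits G (RelHyp.conedOff H T)) :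
    Finite G ∨ ∃ (i : Fin k) (g : Γ), G ≤ (H i).map (MulAut.conj g).toMonoidHom := by
  obtain ⟨S, -, -, hX, hf⟩ := hΓ
  refine or_iff_not_imp_left.2 fun hfin => ?_
  have : Infinite G := not_finite_iff_infinite.1 hfin
  have hc : (RelHyp.conedOff H S).Connected := by
    obtain ⟨δ, -, h⟩ := hX
    exact h.1
  obtain ⟨w, hw⟩ := RelHyp.exists_fixed_of_hasBoundedOrbits (G := G) hX hf
    (fun g => RelHyp.conedOff_adj_smul H S (g : Γ)) (hG.conedOff_of_connected H hc hTfin)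
    -- Group elements have trivial stabilizer, so an infinite one belongs to a cone vertex, all of
    -- whose neighbours are group elements.
    (Sum.inl 1) (RelHyp.smul_inl_injective H G 1) (by
      rintro (a | c) hinf (b | d) hadj
      · exact RelHyp.smul_inl_injective H G b
      · refine absurd ((Set.finite_singleton (1 : G)).subset fun g hg => ?_) hinf
        exact RelHyp.smul_inl_injective H G a (Eq.trans hg (one_smul G _).symm)
      · exact RelHyp.smul_inl_injective H G b
      · exact hadj.elim)
  rcases w with a | ⟨i, c⟩
  · have h1 : ∀ g : G, g = 1 := fun g =>
      RelHyp.smul_inl_injective H G a ((hw g).trans (one_smul G _).symm)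
    have : Subsingleton G := ⟨fun g g' => (h1 g).trans (h1 g').symm⟩
    exact absurd Finite.of_subsingleton hfin
  · induction c using QuotientGroup.induction_on with
    | H a => exact ⟨i, a, RelHyp.le_map_conj_of_forall_smul_eq H hw⟩
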